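/- **Theorem 1 (Theorem 0 in the journal version).** Let $G$ be a (not necessarily finite) group, let $m\ge 1$, and consider a (not necessarily finite) system of equations $\{u_i(x_1,\dots,x_m)=1\mid i\in I\}$ over $G$, where each $u_i$ is a word whose letters are the unknowns $x_1,\dots,x_m$, their inverses, and elements of $G$ (called coefficients). Let $C$ be the centraliser in $G$ of the set of all coefficients of the system. Let $A=(a_{ij})$ be the matrix of the system: the integer matrix in which $a_{ij}$ is the exponent sum of the $j$-th unknown in the $i$-th equation. Let $\Delta_k$ be the greatest common divisor of all minors of order $k$ of $A$, with the conventions that $\Delta_0=1$, that $\Delta_k=0$ if $k$ is larger than the number of equations, and that $\frac00=0$. Then the number of solutions of the system in $G$ (that is, the cardinality of the set of all $(g_1,\dots,g_m)\in G^m$ satisfying all equations) is divisible by $$\mathrm{GCD}\left(C,\ \frac{\Delta_m}{\Delta_{m-1}}\right).$$ Here, for a group $H$ and an integer $n$, $\mathrm{GCD}(H,n)$ denotes the least common multiple of the orders of those subgroups of $H$ whose order divides $n$. Divisibility is understood in the sense of cardinal arithmetic: an infinite cardinal is divisible by all nonzero cardinals not exceeding it, and zero is divisible by all cardinals and divides only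 zero. (In particular, $\mathrm{GCD}(H,0)=|H|$, and $\mathrm{GCD}(H,n)=\mathrm{gcd}(|H|,n)$ if $H$ is finite.) -/

import Mathlib

universe u v

namespace GroupEquations

/-- A letter of the left-hand side of an equation over a group `G` in the unknowns
`x_0, …, x_{m-1}`: a coefficient from `G`, an unknown, or the inverse of an unknown. -/
inductive Letter (G : Type u) (m : ℕ) : Type u
  | coeff (g : G) : Letter G m
  | unknown (j : Fin m) : Letter G m
  | unknownInv (j : Fin m) : Letter G m

/-- The value of a letter when the unknowns take the values `x`. -/
def Letter.eval {G : Type u} [Group G] {m : ℕ} (x : Fin m → G) : Letter G m → G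
  | .coeff g => g
  | .unknown j => x j
  | .unknownInv j => (x j)⁻¹

/-- The contribution of a letter to the exponent sum of the `j`-th unknown. -/
def Letter.exponent {G : Type u} {m : ℕ} (j : Fin m) : Letter G m → ℤ
  | .coeff _ => 0
  | .unknown i => if i = j then 1 else 0
  | .unknownInv i => if i = j then -1 else 0

/-- A word `v(x_0, …, x_{m-1})`; it stands for the equation `v(x_0, …, x_{m-1}) = 1`. -/
abbrev Word (G : Type u) (m : ℕ) : Type u := List (Letter G m)

/-- The value in `G` of a word when the unknowns take the values `x`. -/
def Word.eval {G : Type u} [Group G] {m : ℕ} (x : Fin m → G) (w : Word G m) : G :=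
  (w.map (Letter.eval x)).prod

/-- The exponent sum of the `j`-th unknown in a word. -/
def Word.exponentSum {G : Type u} {m : ℕ} (w : Word G m) (j : Fin m) : ℤ :=
  (w.map (Letter.exponent j)).sum

/-- A system of equations `u i = 1`, `i ∈ I`, over `G` in `m` unknowns; `I` may be infinite. -/
abbrev System (G : Type u) (I : Type v) (m : ℕ) : Type (max u v) := I → Word G m

/-- The set of solutions in `G` of a system. -/
def System.solutions {G : Type u} [Group G] {I : Type v} {m : ℕ} (S : System G I m) :
    Set (Fin m → G) :=
  {x | ∀ i, (S i).eval x = 1}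

/-- The set of coefficients of a system: the elements of `G` occurring in its words. -/
def System.coefficients {G : Type u} {I : Type v} {m : ℕ} (S : System G I m) : Set G :=
  {g | ∃ i, Letter.coeff g ∈ S i}

/-- The matrix of a system: its `(i, j)` entry is the exponent sum of the `j`-th unknown in the
`i`-th equation. -/
def System.matrix {G : Type u} {I : Type v} {m : ℕ} (S : System G I m) : Matrix I (Fin m) ℤ :=
  Matrix.of fun i j => (S i).exponentSum j

/-- The minors of order `k` of an integer matrix: determinants of submatrices on `k` distinct rows
and `k` distinct columns (each minor appears with both signs when `k ≥ 2`, which does not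
affect greatest common divisors). -/
def minors {I : Type v} {m : ℕ} (A : Matrix I (Fin m) ℤ) (k : ℕ) : Set ℤ :=
  {d | ∃ (r : Fin k ↪ I) (c : Fin k ↪ Fin m), d = (A.submatrix r c).det}

/-- The nonnegative greatest common divisor of a possibly infinite set of integers; it is `0` if
the set has no nonzero elements, in particular if the set is empty. -/
noncomputable def gcdSet (s : Set ℤ) : ℕ :=
  (Submodule.IsPrincipal.generator (Ideal.span s)).natAbs

theorem dvd_gcdSet_iff (s : Set ℤ) (d : ℤ) : d ∣ (gcdSet s : ℤ) ↔ ∀ a ∈ s, d ∣ a := by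
  rw [gcdSet, Int.dvd_natAbs, ← Ideal.mem_span_singleton, ← Ideal.span_singleton_le_iff_mem,
    Ideal.span_singleton_generator, Ideal.span_le]
  simp only [Set.subset_def, SetLike.mem_coe, Ideal.mem_span_singleton]

/-- `Δ_k`: the greatest common divisor of all minors of order `k`. In particular `Δ_0 = 1`, and
`Δ_k = 0` if `k` is larger than the number of rows. -/
noncomputable def Delta {I : Type v} {m : ℕ} (A : Matrix I (Fin m) ℤ) (k : ℕ) : ℕ :=
  gcdSet (minors A k)

/-- The least common multiple of a set of nonzero cardinals: the least nonzero cardinal divisible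
by all of them. -/
noncomputable def cardinalLcm (s : Set Cardinal.{u}) : Cardinal.{u} :=
  sInf {c | c ≠ 0 ∧ ∀ a ∈ s, a ∣ c}

/-- The greatest common divisor `GCD(G, n)` of a group `G` and an integer `n ≥ 0`: the least
common multiple of the orders of those subgroups of `G` whose order divides `n`. -/
noncomputable def groupGcd (G : Type u) [Group G] (n : ℕ) : Cardinal.{u} :=
  cardinalLcm {c | ∃ H : Subgroup G, c = Cardinal.mk H ∧ c ∣ (n : Cardinal.{u})}

end GroupEquations

namespace GroupEquations

open scoped Matrix

/-! Put n = Δ_m/Δ_{m-1}; it suffices to treat one subgroup H ≤ C whose order divides n. Solutions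
are homomorphisms φ from a free group F to G with prescribed values on the coefficient letters. By
`exists_unimodular_vector` there is a primitive integer vector e with Ae ≡ 0 mod n. Giving the
unknowns the degrees e_j and the coefficients degree 0 yields a map of F onto ℤ under which every
equation has degree divisible by n. Let N consist of the elements of such degrees.

H acts on solutions by conjugation, in general not freely. Call φ and ψ close if they agree on N and
φ(w)⁻¹ψ(w) always lies in U = `conjCore N H φ`. The action permutes the classes, and the stabilizer
of the class of φ is U (`close_conjHom_iff`). The class is also equipotent with U: for t of degree
one, ψ(t) = φ(t)x with x ∈ U arbitrary, and x determines ψ (`exists_close_of_mem_conjCore`).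
Existence of ψ rests on the Brauer-type identity (φ(t)x)^n = φ(t)^n (`mul_pow_eq_pow`). Burnside's
count of the pairs (class, element fixing it) then gives |H| times the number of orbits
(`mk_dvd_mk_of_class_equiv`). -/

/-! ### Cardinal divisibility and orbit counting. -/

theorem cardinalLcm_dvd {s : Set Cardinal.{u}} {N : Cardinal.{u}} (h : ∀ a ∈ s, a ∣ N) :
    cardinalLcm s ∣ N := by
  rcases eq_or_ne N 0 with rfl | hN
  · exact dvd_zero _
  have hmem : cardinalLcm s ∈ {c : Cardinal.{u} | c ≠ 0 ∧ ∀ a ∈ s, a ∣ c} :=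
    csInf_mem ⟨N, hN, h⟩
  have hmin : ∀ c : Cardinal.{u}, c ≠ 0 → (∀ a ∈ s, a ∣ c) → cardinalLcm s ≤ c :=
    fun c h0 hc => csInf_le' ⟨h0, hc⟩
  generalize cardinalLcm s = c at hmem hmin
  obtain ⟨hc0, hc⟩ := hmem
  rcases le_or_gt Cardinal.aleph0 N with hinf | hfin
  · exact Cardinal.dvd_of_le_of_aleph0_le hc0 (hmin N hN h) hinf
  obtain ⟨k, rfl⟩ := Cardinal.lt_aleph0.1 hfin
  obtain ⟨l, rfl⟩ := Cardinal.lt_aleph0.1 ((hmin _ hN h).trans_lt hfin)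
  rw [Cardinal.nat_coe_dvd_iff]
  by_contra hkl
  have hmod : k % l ≠ 0 := fun h0 => hkl (Nat.dvd_of_mod_eq_zero h0)
  -- The remainder would be a smaller nonzero common multiple.
  have hle := hmin ((k % l : ℕ) : Cardinal.{u}) (by exact_mod_cast hmod) fun a ha => by
    obtain ⟨b, rfl⟩ := Cardinal.lt_aleph0.1
      ((Cardinal.le_of_dvd hN (h a ha)).trans_lt hfin)
    have h1 := h _ ha
    have h2 := hc _ ha
    rw [Cardinal.nat_coe_dvd_iff] at h1 h2 ⊢
    exact (Nat.dvd_mod_iff h2).2 h1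
  have hl : 0 < l := Nat.pos_of_ne_zero (by exact_mod_cast hc0)
  exact absurd (Nat.cast_le.1 hle) (not_le.2 (Nat.mod_lt _ hl))

/-- If every fibre of an equivariant quotient has as many elements as the corresponding
stabilizer, then the order of the group divides the cardinality of the set. -/
theorem mk_dvd_mk_of_class_equiv {H X : Type u} [Group H] [MulAction H X] (r : Setoid X)
    (hr : ∀ (h : H) x y, r x y → r (h • x) (h • y))
    (e : ∀ x, Nonempty ({y // r x y} ≃ {h : H // r x (h • x)})) :
    Cardinal.mk H ∣ Cardinal.mk X := by
  let _ : MulAction H (Quotient r) :=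
    { smul := fun h => Quotient.map (h • ·) (hr h)
      one_smul := fun y => Quotient.inductionOn y fun x =>
        congrArg (Quotient.mk r) (one_smul H x)
      mul_smul := fun g h y => Quotient.inductionOn y fun x =>
        congrArg (Quotient.mk r) (mul_smul g h x) }
  have key : ∀ y : Quotient r, Nonempty ({x // Quotient.mk r x = y} ≃ {h : H // h • y = y}) := by
    intro y
    induction y using Quotient.inductionOn with
    | _ x =>
      obtain ⟨e'⟩ := e x
      refine ⟨((Equiv.subtypeEquivRight fun z => ?_).trans e').trans
        (Equiv.subtypeEquivRight fun h => ?_)⟩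
      · exact Quotient.eq.trans ⟨r.symm', r.symm'⟩
      · exact Iff.trans ⟨r.symm', r.symm'⟩ (Quotient.eq (x := h • x) (y := x)).symm
  have e1 : X ≃ Σ y : Quotient r, {h : H // h • y = y} :=
    (Equiv.sigmaFiberEquiv (Quotient.mk r)).symm.trans
      (Equiv.sigmaCongrRight fun y => (key y).some)
  -- Burnside's double count, as a bijection so that it covers infinite sets.
  have e2 : (Σ y : Quotient r, {h : H // h • y = y}) ≃
      Σ h : H, MulAction.fixedBy (Quotient r) h :=
    { toFun := fun p => ⟨p.2.1, p.1, p.2.2⟩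
      invFun := fun p => ⟨p.2.1, p.1, p.2.2⟩
      left_inv := fun _ => rfl
      right_inv := fun _ => rfl }
  have e3 := (e1.trans e2).trans (MulAction.sigmaFixedByEquivOrbitsProdGroup H (Quotient r))
  rw [Cardinal.mk_congr e3, Cardinal.mk_prod, Cardinal.lift_id, Cardinal.lift_id]
  exact dvd_mul_left _ _

/-! ### Brauer's lemma. -/

theorem dvd_card_of_dvd_minimalPeriod {X : Type*} [Finite X] (σ : Equiv.Perm X) (q : ℕ)
    (h : ∀ x, q ∣ Function.minimalPeriod σ x) : q ∣ Nat.card X := by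
  classical
  have := Fintype.ofFinite X
  have e := MulAction.selfEquivSigmaOrbits (Subgroup.zpowers σ) X
  have := Fintype.ofFinite (Quotient (MulAction.orbitRel (Subgroup.zpowers σ) X))
  rw [Nat.card_congr e, Nat.card_sigma]
  refine Finset.dvd_sum fun ω _ => ?_
  rw [Nat.card_eq_fintype_card, ← MulAction.minimalPeriod_eq_card]
  exact h _

/-- A special case of a lemma of Brauer. -/
theorem mul_pow_eq_pow {G : Type*} [Group G] (U : Subgroup G) [Finite U] {a u : G}
    (ha : ∀ x ∈ U, a * x * a⁻¹ ∈ U) (hu : u ∈ U) {n : ℕ} (hn : Nat.card U ∣ n)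
    (hc : ∀ x ∈ U, Commute (a ^ n) x) : (a * u) ^ n = a ^ n := by
  -- The k-th iterate is x ↦ (au)^k x a^{-k}. For k = n this is left translation by v = (au)^n
  -- a^{-n}, as a^n centralizes U.
  let s : U → U := fun x => ⟨a * u * x * a⁻¹, by
    have := ha _ (U.mul_mem hu x.2)
    rwa [← mul_assoc] at this⟩
  have hs : Function.Injective s := fun x y hxy => by
    have := congrArg Subtype.val hxy
    simpa [s] using this
  let σ : Equiv.Perm U := Equiv.ofBijective s (Finite.injective_iff_bijective.1 hs)
  have hσ : ∀ (k : ℕ) (x : U), ((σ^[k] x : U) : G) = (a * u) ^ k * x * (a ^ k)⁻¹ := by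
    intro k
    induction k with
    | zero => simp
    | succ k ih =>
      intro x
      rw [Function.iterate_succ_apply', pow_succ' (a * u), pow_succ' a]
      change a * u * (σ^[k] x : U) * a⁻¹ = _
      rw [ih]
      group
  have hσn : ∀ x : U, ((σ^[n] x : U) : G) = (a * u) ^ n * (a ^ n)⁻¹ * x := fun x => by
    rw [hσ, mul_assoc, ← ((hc x x.2).inv_left).eq, mul_assoc]
  have hv : (a * u) ^ n * (a ^ n)⁻¹ ∈ U := by
    have := (σ^[n] 1).2
    rw [hσn] at this
    simpa using this
  set v : U := ⟨(a * u) ^ n * (a ^ n)⁻¹, hv⟩ with hvdef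
  -- A cycle of σ of length p splits under σ^n into cycles of length p / gcd(p, n), while all cycles
  -- of translation by v have length `orderOf v`.
  have hperiod : ∀ x : U, Function.minimalPeriod σ x
      = orderOf v * Nat.gcd (Function.minimalPeriod σ x) n := by
    intro x
    have hpos : x ∈ Function.periodicPts σ :=
      Function.Injective.mem_periodicPts σ.injective x
    have h1 := Function.minimalPeriod_iterate_eq_div_gcd' hpos (n := n)
    have h2 : Function.minimalPeriod (σ^[n]) x = orderOf v := by
      have hfun : (σ^[n] : U → U) = (v * ·) := by
        funext y
        exact Subtype.ext (hσn y)
      rw [hfun]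
      apply Function.minimalPeriod_eq_minimalPeriod_iff.2
      intro k
      rw [Function.IsPeriodicPt, Function.IsFixedPt, isPeriodicPt_mul_iff_pow_eq_one,
        mul_left_iterate]
      simp
    rw [h2] at h1
    rw [h1, Nat.div_mul_cancel (Nat.gcd_dvd_left _ _)]
  -- Bootstrapping: a common divisor of all cycle lengths divides |U|, hence n, hence the gcd in
  -- `hperiod`, which supplies one more factor `orderOf v`.
  have hpow : ∀ (j : ℕ) (x : U), orderOf v ^ j ∣ Function.minimalPeriod σ x := by
    intro j
    induction j with
    | zero => simp
    | succ j ih =>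
      intro x
      rw [hperiod x, pow_succ']
      exact mul_dvd_mul_left _
        (Nat.dvd_gcd (ih x) ((dvd_card_of_dvd_minimalPeriod σ _ ih).trans hn))
  have hone : orderOf v = 1 := by
    by_contra hne
    have hpos := orderOf_pos v
    have hcard : 0 < Nat.card U := Nat.card_pos
    have hle := Nat.le_of_dvd hcard
      (dvd_card_of_dvd_minimalPeriod σ _ (hpow (Nat.card U)))
    exact absurd hle (not_le.2 (Nat.lt_pow_self (by omega)))
  have := congrArg Subtype.val (orderOf_eq_one_iff.1 hone)
  exact mul_inv_eq_one.1 this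

/-! ### Close homomorphisms and their cores. -/

/-- The elements of `H` all of whose conjugates by elements of the image of `φ` lie in `H` and
centralize the image of `N`. -/
def conjCore {F G : Type*} [Group F] [Group G] (N : Subgroup F) (H : Subgroup G) (φ : F →* G) :
    Subgroup G :=
  ⨅ w, (H ⊓ Subgroup.centralizer (φ '' N)).comap (MulAut.conj (φ w)).toMonoidHom

section

variable {F G : Type*} [Group F] [Group G] {N : Subgroup F} {H : Subgroup G} {φ ψ : F →* G}

theorem mem_conjCore {x : G} :
    x ∈ conjCore N H φ ↔
      ∀ w, φ w * x * (φ w)⁻¹ ∈ H ∧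
        ∀ a ∈ N, φ a * (φ w * x * (φ w)⁻¹) = φ w * x * (φ w)⁻¹ * φ a := by
  simp only [conjCore, Subgroup.mem_iInf, Subgroup.mem_comap, Subgroup.mem_inf,
    Subgroup.mem_centralizer_iff, Set.forall_mem_image, SetLike.mem_coe]
  rfl

theorem conj_mem_conjCore {x : G} (hx : x ∈ conjCore N H φ) (w : F) :
    φ w * x * (φ w)⁻¹ ∈ conjCore N H φ := by
  rw [mem_conjCore] at hx ⊢
  intro w'
  have := hx (w' * w)
  simpa [mul_assoc] using this

theorem conjCore_le : conjCore N H φ ≤ H := fun x hx => by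
  simpa using (mem_conjCore.1 hx 1).1

theorem commute_of_mem_conjCore {x : G} (hx : x ∈ conjCore N H φ) {a : F} (ha : a ∈ N) :
    φ a * x = x * φ a := by
  simpa using (mem_conjCore.1 hx 1).2 a ha

/-- Two homomorphisms are close if they agree on `N` and differ by elements of the core. -/
def Close (N : Subgroup F) (H : Subgroup G) (φ ψ : F →* G) : Prop :=
  (∀ a ∈ N, ψ a = φ a) ∧ ∀ w, (φ w)⁻¹ * ψ w ∈ conjCore N H φ

/-- Conjugation by ψ(w) is conjugation by an element of the core, which preserves the core, followed
by conjugation by φ(w). Thus the core is constant on classes, which makes closeness symmetric and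
transitive. -/
theorem Close.conjCore_le_conjCore (h : Close N H φ ψ) : conjCore N H φ ≤ conjCore N H ψ := by
  intro x hx
  rw [mem_conjCore]
  intro w
  have hu := h.2 w
  have key := mem_conjCore.1
    ((conjCore N H φ).mul_mem ((conjCore N H φ).mul_mem hu hx) ((conjCore N H φ).inv_mem hu)) w
  have heq : φ w * ((φ w)⁻¹ * ψ w * x * ((φ w)⁻¹ * ψ w)⁻¹) * (φ w)⁻¹ = ψ w * x * (ψ w)⁻¹ := by
    group
  rw [heq] at key
  exact ⟨key.1, fun a ha => by rw [h.1 a ha]; exact key.2 a ha⟩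

theorem Close.symm (h : Close N H φ ψ) : Close N H ψ φ :=
  ⟨fun a ha => (h.1 a ha).symm, fun w => by
    have := (conjCore N H ψ).inv_mem (h.conjCore_le_conjCore (h.2 w))
    simpa using this⟩

theorem Close.refl (φ : F →* G) : Close N H φ φ :=
  ⟨fun _ _ => rfl, fun w => by simp⟩

theorem Close.trans {χ : F →* G} (h : Close N H φ ψ) (h' : Close N H ψ χ) : Close N H φ χ :=
  ⟨fun a ha => (h'.1 a ha).trans (h.1 a ha), fun w => by
    have := (conjCore N H φ).mul_mem (h.2 w) (h.symm.conjCore_le_conjCore (h'.2 w))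
    simpa [mul_assoc] using this⟩

/-- The composition of a homomorphism with an inner automorphism. -/
def conjHom (h : G) (φ : F →* G) : F →* G := (MulAut.conj h).toMonoidHom.comp φ

@[simp] theorem conjHom_apply (h : G) (φ : F →* G) (w : F) : conjHom h φ w = h * φ w * h⁻¹ := rfl

theorem conj_mem_conjCore_conjHom {h x : G} (hh : h ∈ H) (hx : x ∈ conjCore N H φ) :
    h * x * h⁻¹ ∈ conjCore N H (conjHom h φ) := by
  rw [mem_conjCore] at hx ⊢
  intro w
  obtain ⟨h1, h2⟩ := hx w
  have heq : conjHom h φ w * (h * x * h⁻¹) * (conjHom h φ w)⁻¹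
      = h * (φ w * x * (φ w)⁻¹) * h⁻¹ := by
    rw [conjHom_apply]
    group
  rw [heq]
  refine ⟨H.mul_mem (H.mul_mem hh h1) (H.inv_mem hh), fun a ha => ?_⟩
  have := h2 a ha
  generalize φ w * x * (φ w)⁻¹ = y at this
  calc conjHom h φ a * (h * y * h⁻¹) = h * (φ a * y) * h⁻¹ := by rw [conjHom_apply]; group
    _ = h * y * h⁻¹ * conjHom h φ a := by rw [this, conjHom_apply]; group

theorem Close.conjHom {h : G} (hh : h ∈ H) (hc : Close N H φ ψ) :
    Close N H (conjHom h φ) (conjHom h ψ) :=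
  ⟨fun a ha => by simp [hc.1 a ha], fun w => by
    have := conj_mem_conjCore_conjHom hh (hc.2 w)
    simpa [mul_assoc] using this⟩

/-- Agreement on N says that h centralizes φ(N). A conjugate of h by φ(w) is h times a ratio of the
two homomorphisms, so it lies in H and centralizes φ(N) once the ratio is in the core. -/
theorem close_conjHom_iff {h : G} (hh : h ∈ H) :
    Close N H φ (conjHom h φ) ↔ h ∈ conjCore N H φ := by
  constructor
  · rintro ⟨h1, h2⟩
    have hcomm : ∀ a ∈ N, φ a * h = h * φ a := fun a ha =>
      (mul_inv_eq_iff_eq_mul.1 (h1 a ha)).symm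
    rw [mem_conjCore]
    intro w
    have h3 := h2 w⁻¹
    have hu : φ w * h * (φ w)⁻¹ = ((φ w⁻¹)⁻¹ * conjHom h φ w⁻¹) * h := by
      simp [mul_assoc]
    rw [hu]
    refine ⟨H.mul_mem (conjCore_le h3) hh, fun a ha => ?_⟩
    rw [← mul_assoc, commute_of_mem_conjCore h3 ha, mul_assoc, hcomm a ha, mul_assoc, mul_assoc,
      mul_assoc]
  · intro hx
    refine ⟨fun a ha => ?_, fun w => ?_⟩
    · rw [conjHom_apply, ← commute_of_mem_conjCore hx ha, mul_inv_cancel_right]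
    · have h1 := conj_mem_conjCore hx w⁻¹
      have := (conjCore N H φ).mul_mem h1 ((conjCore N H φ).inv_mem hx)
      simpa [mul_assoc] using this

end

/-! ### Modifying a homomorphism outside the degrees divisible by n. -/

section

variable {F G : Type*} [Group F] [Group G]

/-- The elements of a group whose degree is divisible by `n`. -/
def degreeSubgroup (deg : F →* Multiplicative ℤ) (n : ℕ) : Subgroup F :=
  (Subgroup.zpowers (Multiplicative.ofAdd (n : ℤ))).comap deg

theorem mem_degreeSubgroup {deg : F →* Multiplicative ℤ} {n : ℕ} {w : F} :
    w ∈ degreeSubgroup deg n ↔ (n : ℤ) ∣ (deg w).toAdd := by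
  rw [degreeSubgroup, Subgroup.mem_comap, Subgroup.mem_zpowers_iff]
  constructor
  · rintro ⟨k, hk⟩
    rw [← hk, ← ofAdd_zsmul, toAdd_ofAdd]
    exact ⟨k, by rw [smul_eq_mul, mul_comm]⟩
  · rintro ⟨k, hk⟩
    exact ⟨k, by rw [← ofAdd_zsmul, smul_eq_mul, mul_comm, ← hk, ofAdd_toAdd]⟩

variable {deg : F →* Multiplicative ℤ} {t : F} {n : ℕ} {H : Subgroup G} {φ : F →* G}

theorem mul_zpow_mem_degreeSubgroup (ht : deg t = Multiplicative.ofAdd 1) (w : F) :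
    w * t ^ (-(deg w).toAdd) ∈ degreeSubgroup deg n := by
  rw [mem_degreeSubgroup]
  simp [ht]

/-- A homomorphism agreeing with `φ` in degrees divisible by `n`, with prescribed value on an
element of degree one. -/
theorem exists_close_of_mem_conjCore (ht : deg t = Multiplicative.ofAdd 1)
    (hH : Cardinal.mk H ∣ (n : Cardinal)) {x : G}
    (hx : x ∈ conjCore (degreeSubgroup deg n) H φ) :
    ∃ ψ : F →* G, Close (degreeSubgroup deg n) H φ ψ ∧ ψ t = φ t * x := by
  set U := conjCore (degreeSubgroup deg n) H φ with hU
  have hconj : ∀ (k : ℤ), ∀ y ∈ U, φ t ^ k * y * (φ t ^ k)⁻¹ ∈ U := fun k y hy => by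
    have := conj_mem_conjCore hy (t ^ k)
    rwa [map_zpow] at this
  -- The ratio of the new and old values at t^k: a U-valued cocycle on ℤ, to be pulled back along
  -- the degree.
  let τ : ℤ → G := fun k => (φ t ^ k)⁻¹ * (φ t * x) ^ k
  have hτadd : ∀ k l, τ (k + l) = (φ t ^ l)⁻¹ * τ k * φ t ^ l * τ l := fun k l => by
    simp only [τ, zpow_add]
    group
  have hconj' : ∀ (k : ℤ), ∀ y ∈ U, (φ t ^ k)⁻¹ * y * φ t ^ k ∈ U := fun k y hy => by
    have := hconj (-k) y hy
    rwa [zpow_neg, inv_inv] at this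
  have hτ1 : τ 1 = x := by simp [τ]
  have hτ0 : τ 0 = 1 := by simp [τ]
  have hτmem : ∀ k, τ k ∈ U := by
    intro k
    induction k using Int.induction_on with
    | zero => rw [hτ0]; exact U.one_mem
    | succ k ih =>
      rw [hτadd, hτ1]
      exact U.mul_mem (hconj' _ _ ih) hx
    | pred k ih =>
      have h1 := hτadd (-k - 1) 1
      rw [sub_add_cancel, hτ1] at h1
      have h2 : τ (-k - 1) = φ t ^ (1 : ℤ) * (τ (-k) * x⁻¹) * (φ t ^ (1 : ℤ))⁻¹ := by
        rw [h1]
        group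
      rw [h2]
      exact hconj _ _ (U.mul_mem ih (U.inv_mem hx))
  have hτn : ∀ k : ℤ, (n : ℤ) ∣ k → τ k = 1 := by
    rintro _ ⟨l, rfl⟩
    have hpow : (φ t * x) ^ n = φ t ^ n := by
      -- For n = 0 the subgroup H may be infinite, but the identity is trivial.
      rcases eq_or_ne n 0 with rfl | hn
      · simp
      have hfin : Finite H := by
        rw [← Cardinal.mk_lt_aleph0_iff]
        exact (Cardinal.le_of_dvd (by exact_mod_cast hn) hH).trans_lt (Cardinal.natCast_lt_aleph0)
      have hcard : Nat.card H ∣ n := by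
        rw [← Nat.cast_card, Cardinal.nat_coe_dvd_iff] at hH
        exact hH
      have hfinU : Finite U := Finite.Set.subset (H : Set G) conjCore_le
      refine mul_pow_eq_pow U (fun y hy => ?_) hx
        ((Subgroup.card_dvd_of_le conjCore_le).trans hcard) fun y hy => ?_
      · simpa using hconj 1 y hy
      · have htn : t ^ n ∈ degreeSubgroup deg n := by
          rw [mem_degreeSubgroup, map_pow, ht]
          simp
        have := commute_of_mem_conjCore hy htn
        rwa [map_pow] at this
    simp only [τ]
    rw [zpow_mul, zpow_mul, zpow_natCast, zpow_natCast, hpow, inv_mul_cancel]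
  -- Since w t^{-deg w} has degree 0, it lies in N and its image centralizes U; so φ(w) acts on U as
  -- φ(t)^{deg w}.
  have hdeg : ∀ (w : F), ∀ y ∈ U, (φ w)⁻¹ * y * φ w =
      (φ t ^ (deg w).toAdd)⁻¹ * y * φ t ^ (deg w).toAdd := by
    intro w y hy
    have h1 := commute_of_mem_conjCore hy (mul_zpow_mem_degreeSubgroup (n := n) ht w)
    rw [map_mul, map_zpow, zpow_neg] at h1
    have h2 : φ w = φ w * (φ t ^ (deg w).toAdd)⁻¹ * φ t ^ (deg w).toAdd := by
      rw [inv_mul_cancel_right]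
    generalize φ w * (φ t ^ (deg w).toAdd)⁻¹ = z at h1 h2
    rw [h2, mul_inv_rev, mul_assoc, mul_assoc, ← mul_assoc y, ← h1]
    group
  let ψ : F →* G := MonoidHom.mk' (fun w => φ w * τ (deg w).toAdd) fun v w => by
    have h1 := hdeg w _ (hτmem (deg v).toAdd)
    rw [map_mul, map_mul, toAdd_mul, hτadd, ← h1]
    group
  refine ⟨ψ, ⟨fun a ha => ?_, fun w => ?_⟩, ?_⟩
  · change φ a * τ (deg a).toAdd = φ a
    rw [hτn _ (mem_degreeSubgroup.1 ha), mul_one]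
  · change (φ w)⁻¹ * (φ w * τ (deg w).toAdd) ∈ U
    rw [inv_mul_cancel_left]
    exact hτmem _
  · change φ t * τ (deg t).toAdd = φ t * x
    rw [ht, toAdd_ofAdd, hτ1]

theorem eq_of_eqOn_degreeSubgroup {ψ χ : F →* G} (ht : deg t = Multiplicative.ofAdd 1)
    (h : ∀ a ∈ degreeSubgroup deg n, ψ a = χ a) (h1 : ψ t = χ t) : ψ = χ := by
  ext w
  have h2 := h _ (mul_zpow_mem_degreeSubgroup (n := n) ht w)
  rwa [map_mul, map_mul, map_zpow, map_zpow, h1, mul_left_inj] at h2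

/-- A set of homomorphisms from a group with a degree map onto `ℤ` has cardinality divisible by the
order of a subgroup `H` dividing `n`, provided that it is stable under conjugation by `H` and under
changes of homomorphisms outside of the degrees divisible by `n`. -/
theorem mk_dvd_mk_of_conjHom_mem {F G : Type u} [Group F] [Group G]
    {deg : F →* Multiplicative ℤ} {t : F} {n : ℕ} {H : Subgroup G}
    (ht : deg t = Multiplicative.ofAdd 1) (hH : Cardinal.mk H ∣ (n : Cardinal.{u}))
    (Φ : Set (F →* G)) (hconj : ∀ h ∈ H, ∀ φ ∈ Φ, conjHom h φ ∈ Φ)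
    (hext : ∀ φ ∈ Φ, ∀ ψ : F →* G, (∀ a ∈ degreeSubgroup deg n, ψ a = φ a) → ψ ∈ Φ) :
    Cardinal.mk H ∣ Cardinal.mk Φ := by
  let _ : MulAction H Φ :=
    { smul := fun h φ => ⟨conjHom h φ, hconj h h.2 φ φ.2⟩
      one_smul := fun φ => Subtype.ext <| MonoidHom.ext fun w => by
        change ((1 : H) : G) * φ.1 w * ((1 : H) : G)⁻¹ = φ.1 w
        simp
      mul_smul := fun g h φ => Subtype.ext <| MonoidHom.ext fun w => by
        change ((g * h : H) : G) * φ.1 w * ((g * h : H) : G)⁻¹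
          = g * (h * φ.1 w * (h : G)⁻¹) * (g : G)⁻¹
        simp [mul_assoc] }
  let r : Setoid Φ :=
    { r := fun φ ψ => Close (degreeSubgroup deg n) H φ.1 ψ.1
      iseqv := ⟨fun _ => Close.refl _, Close.symm, Close.trans⟩ }
  refine mk_dvd_mk_of_class_equiv r (fun h φ ψ hc => hc.conjHom h.2) fun φ => ?_
  have e1 : {h : H // r φ (h • φ)} ≃ conjCore (degreeSubgroup deg n) H φ.1 :=
    { toFun := fun h => ⟨h.1, (close_conjHom_iff h.1.2).1 h.2⟩
      invFun := fun h => ⟨⟨h.1, conjCore_le h.2⟩, (close_conjHom_iff (conjCore_le h.2)).2 h.2⟩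
      left_inv := fun _ => rfl
      right_inv := fun _ => rfl }
  let f : {ψ : Φ // r φ ψ} → conjCore (degreeSubgroup deg n) H φ.1 :=
    fun ψ => ⟨(φ.1 t)⁻¹ * ψ.1.1 t, ψ.2.2 t⟩
  have hf : Function.Bijective f := by
    constructor
    · intro ψ χ hψχ
      have h1 : (φ.1 t)⁻¹ * ψ.1.1 t = (φ.1 t)⁻¹ * χ.1.1 t := congrArg Subtype.val hψχ
      exact Subtype.ext <| Subtype.ext <| eq_of_eqOn_degreeSubgroup ht
        (fun a ha => (ψ.2.1 a ha).trans (χ.2.1 a ha).symm) (mul_left_cancel h1)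
    · rintro ⟨x, hx⟩
      obtain ⟨ψ, hψ, hψt⟩ := exists_close_of_mem_conjCore ht hH hx
      refine ⟨⟨⟨ψ, hext _ φ.2 ψ hψ.1⟩, hψ⟩, Subtype.ext ?_⟩
      change (φ.1 t)⁻¹ * ψ t = x
      rw [hψt, inv_mul_cancel_left]
  exact ⟨(Equiv.ofBijective f hf).trans e1.symm⟩

end

/-! ### Minors and unimodular vectors over ℤ. -/

/-- A nonzero bilinear form over `ℤ` attains a value that divides all its values. -/
theorem exists_bilin_dvd {M N : Type*} [AddCommGroup M] [AddCommGroup N]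
    (β : M →ₗ[ℤ] N →ₗ[ℤ] ℤ) : ∃ r c, ∀ r' c', β r c ∣ β r' c' := by
  classical
  by_cases hβ : ∀ r c, β r c = 0
  · exact ⟨0, 0, fun r' c' => by simp [hβ]⟩
  push Not at hβ
  have hex : ∃ k : ℕ, 0 < k ∧ ∃ r c, β r c = k := by
    obtain ⟨r, c, h⟩ := hβ
    rcases lt_or_gt_of_ne h with h | h
    · exact ⟨(β r c).natAbs, by omega, -r, c, by
        rw [map_neg, LinearMap.neg_apply]; omega⟩
    · exact ⟨(β r c).natAbs, by omega, r, c, by omega⟩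
  obtain ⟨hd, r, c, hrc⟩ := Nat.find_spec hex
  have hmin : ∀ r c, 0 < β r c → (Nat.find hex : ℤ) ≤ β r c := fun r c h => by
    have := Nat.find_min' hex (m := (β r c).natAbs) ⟨by omega, r, c, by omega⟩
    omega
  generalize Nat.find hex = d at hd hrc hmin
  have hright : ∀ r, β r c = d → ∀ c', (d : ℤ) ∣ β r c' := by
    intro r hr c'
    by_contra hnd
    have h1 := Int.emod_nonneg (β r c') (b := (d : ℤ)) (by omega)
    have h2 := Int.emod_lt_of_pos (β r c') (b := (d : ℤ)) (by omega)
    have h3 : β r c' % d ≠ 0 := fun h => hnd (Int.dvd_of_emod_eq_zero h)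
    have h4 : β r (c' - (β r c' / d) • c) = β r c' % d := by
      rw [map_sub, map_zsmul, hr, Int.emod_def, smul_eq_mul, mul_comm]
    have := hmin r _ (by rw [h4]; omega)
    omega
  have hleft : ∀ r', (d : ℤ) ∣ β r' c := by
    intro r'
    by_contra hnd
    have h1 := Int.emod_nonneg (β r' c) (b := (d : ℤ)) (by omega)
    have h2 := Int.emod_lt_of_pos (β r' c) (b := (d : ℤ)) (by omega)
    have h3 : β r' c % d ≠ 0 := fun h => hnd (Int.dvd_of_emod_eq_zero h)
    have h4 : β (r' - (β r' c / d) • r) c = β r' c % d := by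
      rw [map_sub, map_zsmul, LinearMap.sub_apply, LinearMap.smul_apply, hrc, Int.emod_def,
        smul_eq_mul, mul_comm]
    have := hmin _ c (by rw [h4]; omega)
    omega
  refine ⟨r, c, fun r' c' => ?_⟩
  rw [hrc]
  obtain ⟨k, hk⟩ := hleft r'
  -- The shift by a multiple of r turns the value dk at c into the minimum d, so `hright` applies to
  -- the shifted vector.
  have h := hright (r' - (k - 1) • r) (by
    rw [map_sub, map_zsmul, LinearMap.sub_apply, LinearMap.smul_apply, hrc, hk, smul_eq_mul]
    ring) c'
  rw [map_sub, map_zsmul, LinearMap.sub_apply, LinearMap.smul_apply] at h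
  exact (dvd_sub_left (Dvd.dvd.mul_left (hright r hrc c') _)).1 h

/-- An integer dividing all minors with given columns of a family of rows divides the minors with
these columns of any family of vectors in the row span. -/
theorem dvd_det_of_mem_span {I : Type v} {m k : ℕ} {d : ℤ} (A : I → Fin m → ℤ)
    (w : Fin k → Fin m → ℤ) (c : Fin k → Fin m)
    (hw : ∀ i, w i ∈ Submodule.span ℤ (Set.range A))
    (hA : ∀ r : Fin k ↪ I, d ∣ (Matrix.of fun i j => A (r i) (c j)).det) :
    d ∣ (Matrix.of fun i j => w i (c j)).det := by
  classical
  choose p hp using fun i => Finsupp.mem_span_range_iff_exists_finsupp.1 (hw i)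
  -- In the multilinear expansion, terms with a repeated row vanish and the others are multiples of
  -- minors of A.
  have h := (Matrix.detRowAlternating (n := Fin k) (R := ℤ)).toMultilinearMap.map_sum_finset
    (fun i a => p i a • fun j => A a (c j)) (fun i => (p i).support)
  have hrow : (fun i => ∑ a ∈ (p i).support, p i a • fun j => A a (c j))
      = Matrix.of fun i j => w i (c j) := by
    funext i j
    change _ = w i (c j)
    rw [← hp i]
    simp [Finsupp.sum, Finset.sum_apply]
  rw [hrow] at h
  change (Matrix.of fun i j => w i (c j)).det = _ at h
  rw [h]
  refine Finset.dvd_sum fun r _ => ?_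
  rw [MultilinearMap.map_smul_univ, smul_eq_mul]
  refine Dvd.dvd.mul_left ?_ _
  by_cases hr : Function.Injective r
  · exact hA ⟨r, hr⟩
  · rw [Function.not_injective_iff] at hr
    obtain ⟨i, j, hij, hne⟩ := hr
    have : (Matrix.detRowAlternating (n := Fin k) (R := ℤ)).toMultilinearMap
        (fun i => fun j => A (r i) (c j)) = 0 :=
      (Matrix.detRowAlternating (n := Fin k) (R := ℤ)).map_eq_zero_of_eq _
        (by rw [hij]) hne
    rw [this]
    exact dvd_zero _

theorem exists_perm_succAbove {k : ℕ} (r : Fin k ↪ Fin (k + 1)) :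
    ∃ (j : Fin (k + 1)) (ρ : Equiv.Perm (Fin k)), ∀ i, r i = j.succAbove (ρ i) := by
  obtain ⟨j, hj⟩ : ∃ j, ∀ i, r i ≠ j := by
    by_contra! h
    have := Fintype.card_le_of_surjective r h
    simp at this
  choose ρ hρ using fun i => Fin.exists_succAbove_eq (hj i)
  have hinj : Function.Injective ρ := fun a b hab => r.injective (by rw [← hρ, ← hρ, hab])
  exact ⟨j, Equiv.ofBijective ρ (Finite.injective_iff_bijective.1 hinj), fun i => (hρ i).symm⟩

theorem dvd_minor_of_dvd_adjugate {k : ℕ} {d : ℤ} (B : Matrix (Fin (k + 1)) (Fin (k + 1)) ℤ)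
    (h : ∀ i j, d ∣ B.adjugate i j) (r c : Fin k ↪ Fin (k + 1)) :
    d ∣ (B.submatrix r c).det := by
  obtain ⟨a, ρ, hρ⟩ := exists_perm_succAbove r
  obtain ⟨b, κ, hκ⟩ := exists_perm_succAbove c
  have h1 : B.submatrix r c
      = ((B.submatrix a.succAbove b.succAbove).submatrix ρ id).submatrix id κ := by
    ext i j
    simp [hρ, hκ]
  have h2 := h b a
  rw [Matrix.adjugate_fin_succ_eq_det_submatrix] at h2
  rw [h1, Matrix.det_permute', Matrix.det_permute]
  refine Dvd.dvd.mul_left (Dvd.dvd.mul_left ?_ _) _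
  rcases neg_one_pow_eq_or ℤ (a + b : ℕ) with h3 | h3 <;> rw [h3] at h2 <;> simpa using h2

/-- With g = Δ_k one has adj B = gE for an integer matrix E. The minors of A of order k are
combinations of those of B, which are entries of adj B up to sign, so the entries of E have gcd 1
and the form of E takes a unit value r·Ec. Take e = Ec: then Be = (det B / g)c, and Δ_{k+1} divides
det B. -/
theorem exists_unimodular_vector_of_basis {I : Type v} {k : ℕ} (A : Matrix I (Fin (k + 1)) ℤ)
    (B : Matrix (Fin (k + 1)) (Fin (k + 1)) ℤ) (hB : B.det ≠ 0)
    (hBA : ∀ i, B i ∈ Submodule.span ℤ (Set.range A))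
    (hAB : ∀ i, A i ∈ Submodule.span ℤ (Set.range B)) :
    ∃ e f : Fin (k + 1) → ℤ, f ⬝ᵥ e = 1 ∧
      ∀ i, ((Delta A (k + 1) / Delta A k : ℕ) : ℤ) ∣ A i ⬝ᵥ e := by
  have hminor : ∀ (r : Fin k ↪ I) (c : Fin k ↪ Fin (k + 1)),
      (Delta A k : ℤ) ∣ (A.submatrix r c).det :=
    fun r c => (dvd_gcdSet_iff _ _).1 dvd_rfl _ ⟨r, c, rfl⟩
  have hD : (Delta A (k + 1) : ℤ) ∣ B.det :=
    dvd_det_of_mem_span A B id hBA fun r =>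
      (dvd_gcdSet_iff _ _).1 dvd_rfl _ ⟨r, Function.Embedding.refl _, rfl⟩
  have hadj : ∀ i j, (Delta A k : ℤ) ∣ B.adjugate i j := by
    intro i j
    rw [Matrix.adjugate_fin_succ_eq_det_submatrix]
    exact Dvd.dvd.mul_left (dvd_det_of_mem_span A (fun a => B (j.succAbove a)) i.succAbove
      (fun a => hBA _) fun r => hminor r (Fin.succAboveEmb i)) _
  have hgD : Delta A k ∣ Delta A (k + 1) := by
    rw [← Int.natCast_dvd_natCast, Delta, Delta, dvd_gcdSet_iff]
    rintro _ ⟨r, c, rfl⟩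
    rw [Matrix.det_succ_row_zero]
    exact Finset.dvd_sum fun j _ => Dvd.dvd.mul_left
      (hminor ((Fin.succEmb k).trans r) ((Fin.succAboveEmb j).trans c)) _
  obtain ⟨q, hq⟩ := hgD
  have hg : Delta A k ≠ 0 := by
    intro h0
    rw [h0, zero_mul] at hq
    rw [hq, Nat.cast_zero, zero_dvd_iff] at hD
    exact hB hD
  rw [hq, Nat.mul_div_cancel_left _ (Nat.pos_of_ne_zero hg)]
  obtain ⟨t, ht⟩ := hD
  rw [hq, Nat.cast_mul] at ht
  generalize hgg : (Delta A k : ℤ) = g at hadj ht hminor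
  have hg0 : g ≠ 0 := by
    rw [← hgg]
    exact_mod_cast hg
  choose E hE using hadj
  obtain ⟨r, c, hrc⟩ := exists_bilin_dvd (Matrix.toBilin' (Matrix.of E))
  have hunit : Matrix.toBilin' (Matrix.of E) r c ∣ 1 := by
    have h1 : ∀ i j, g * Matrix.toBilin' (Matrix.of E) r c ∣ B.adjugate i j := by
      intro i j
      rw [hE]
      refine mul_dvd_mul_left _ ((hrc (Pi.single i 1) (Pi.single j 1)).trans ?_)
      rw [Matrix.toBilin'_single, Matrix.of_apply]
    have h2 : g * Matrix.toBilin' (Matrix.of E) r c ∣ (Delta A k : ℤ) := by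
      rw [Delta, dvd_gcdSet_iff]
      rintro _ ⟨r', c', rfl⟩
      exact dvd_det_of_mem_span B (fun a => A (r' a)) c' (fun a => hAB _) fun r'' =>
        dvd_minor_of_dvd_adjugate B h1 r'' c'
    rw [hgg] at h2
    exact (mul_dvd_mul_iff_left hg0).1 (by rwa [mul_one])
  obtain ⟨s, hs⟩ := hunit
  rw [Matrix.toBilin'_apply'] at hs
  refine ⟨Matrix.of E *ᵥ c, s • r, ?_, fun i => ?_⟩
  · rw [smul_dotProduct, smul_eq_mul, mul_comm, ← hs]
  · have hrow : ∀ i, (q : ℤ) ∣ B i ⬝ᵥ Matrix.of E *ᵥ c := by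
      intro i
      have h1 : B.adjugate = g • Matrix.of E := by
        ext i j
        exact hE i j
      have h2 := congrFun (congrArg (· *ᵥ c) B.mul_adjugate) i
      simp only [h1, Matrix.mul_smul, Matrix.smul_mulVec, Matrix.one_mulVec, Pi.smul_apply,
        smul_eq_mul, ← Matrix.mulVec_mulVec] at h2
      rw [ht, mul_assoc, mul_assoc] at h2
      exact ⟨_, mul_left_cancel₀ hg0 h2⟩
    have hi := hAB i
    generalize A i = x at hi
    induction hi using Submodule.span_induction with
    | mem x hx =>
      obtain ⟨j, rfl⟩ := hx
      exact hrow j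
    | zero => simp
    | add x y _ _ hx hy =>
      rw [add_dotProduct]
      exact dvd_add hx hy
    | smul a x _ hx =>
      rw [smul_dotProduct]
      exact Dvd.dvd.mul_left hx _

theorem exists_unimodular_vector {I : Type v} {m : ℕ} (hm : 1 ≤ m) (A : Matrix I (Fin m) ℤ) :
    ∃ e f : Fin m → ℤ, f ⬝ᵥ e = 1 ∧
      ∀ i, ((Delta A m / Delta A (m - 1) : ℕ) : ℤ) ∣ A i ⬝ᵥ e := by
  obtain ⟨k, rfl⟩ : ∃ k, m = k + 1 := ⟨m - 1, by omega⟩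
  rw [Nat.add_sub_cancel]
  obtain ⟨n, bM, bN, φ, a, hsnf⟩ :=
    Submodule.smithNormalForm (Pi.basisFun ℤ (Fin (k + 1))) (Submodule.span ℤ (Set.range A))
  by_cases hφ : Function.Surjective φ
  · obtain rfl : n = k + 1 := by
      simpa using Fintype.card_of_bijective ⟨φ.injective, hφ⟩
    have hspan : ∀ v ∈ Submodule.span ℤ (Set.range A),
        v ∈ Submodule.span ℤ (Set.range fun i => (bN i : Fin (k + 1) → ℤ)) := by
      intro v hv
      have h1 := Submodule.mem_map_of_mem (f := Submodule.subtype _) (bN.mem_span ⟨v, hv⟩)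
      rw [Submodule.map_span, ← Set.range_comp] at h1
      exact h1
    refine exists_unimodular_vector_of_basis A (Matrix.of fun i => bN i) ?_ (fun i => (bN i).2)
      fun i => hspan _ (Submodule.subset_span ⟨i, rfl⟩)
    intro hdet
    obtain ⟨v, hv, hv0⟩ := Matrix.exists_vecMul_eq_zero_iff.2 hdet
    refine hv (funext fun i => Fintype.linearIndependent_iff.1 bN.linearIndependent v ?_ i)
    refine Subtype.ext ?_
    rw [Matrix.vecMul_eq_sum] at hv0
    change ∑ i, v i • (bN i : Fin (k + 1) → ℤ) = 0 at hv0
    simpa [-zsmul_eq_mul] using hv0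
  -- The row lattice has rank below m. A coordinate functional of the adapted basis vanishes on it;
  -- e is its coefficient vector and f the matching basis vector, so Ae = 0.
  · simp only [Function.Surjective, not_forall, not_exists] at hφ
    obtain ⟨j, hj⟩ := hφ
    have hcoord : ∀ v, v ⬝ᵥ (fun i => bM.coord j (Pi.single i 1)) = bM.coord j v := by
      intro v
      conv_rhs => rw [pi_eq_sum_univ' v]
      simp [-zsmul_eq_mul, dotProduct]
    refine ⟨fun i => bM.coord j (Pi.single i 1), bM j, ?_, fun i => ?_⟩
    · rw [hcoord]
      simp
    · rw [hcoord]
      have h2 : (bM.coord j).comp (Submodule.span ℤ (Set.range A)).subtype = 0 :=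
        bN.ext fun l => by
          simp [-zsmul_eq_mul, hsnf, hj l]
      have h3 := LinearMap.congr_fun h2 ⟨A i, Submodule.subset_span ⟨i, rfl⟩⟩
      simp only [LinearMap.comp_apply, Submodule.subtype_apply, LinearMap.zero_apply] at h3
      rw [h3]
      exact dvd_zero _

/-! ### Solutions as homomorphisms from a free group. -/

/-- A letter as an element of the free group on the coefficients and the unknowns. -/
def Letter.toFreeGroup {G : Type u} {m : ℕ} : Letter G m → FreeGroup (G ⊕ Fin m)
  | .coeff g => FreeGroup.of (Sum.inl g)
  | .unknown j => FreeGroup.of (Sum.inr j)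
  | .unknownInv j => (FreeGroup.of (Sum.inr j))⁻¹

/-- A word as an element of the free group on the coefficients and the unknowns. -/
def Word.toFreeGroup {G : Type u} {m : ℕ} (w : Word G m) : FreeGroup (G ⊕ Fin m) :=
  (w.map Letter.toFreeGroup).prod

theorem map_toFreeGroup {G : Type u} [Group G] {m : ℕ} (φ : FreeGroup (G ⊕ Fin m) →* G)
    (w : Word G m) (h : ∀ g, Letter.coeff g ∈ w → φ (FreeGroup.of (Sum.inl g)) = g) :
    φ (Word.toFreeGroup w) = w.eval fun j => φ (FreeGroup.of (Sum.inr j)) := by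
  rw [Word.toFreeGroup, Word.eval, map_list_prod, List.map_map]
  congr 1
  refine List.map_congr_left fun l hl => ?_
  cases l with
  | coeff g => exact h g hl
  | unknown j => rfl
  | unknownInv j => exact map_inv φ _

/-- The degree map that sends the coefficients to `0` and the `j`-th unknown to `e j`. -/
def degreeHom (G : Type u) {m : ℕ} (e : Fin m → ℤ) :
    FreeGroup (G ⊕ Fin m) →* Multiplicative ℤ :=
  FreeGroup.lift (Sum.elim (fun _ => 1) fun j => Multiplicative.ofAdd (e j))

theorem degreeHom_toFreeGroup {G : Type u} {m : ℕ} (e : Fin m → ℤ) (w : Word G m) :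
    (degreeHom G e (Word.toFreeGroup w)).toAdd = w.exponentSum ⬝ᵥ e := by
  induction w with
  | nil => simp [Word.toFreeGroup, Word.exponentSum, dotProduct]
  | cons l w ih =>
    have h1 : (degreeHom G e l.toFreeGroup).toAdd = (fun j => l.exponent j) ⬝ᵥ e := by
      cases l <;> simp [degreeHom, Letter.toFreeGroup, Letter.exponent, dotProduct]
    have h2 : Word.exponentSum (l :: w) = (fun j => l.exponent j) + Word.exponentSum w := by
      funext j
      simp [Word.exponentSum]
    rw [h2, add_dotProduct, ← ih, ← h1, ← toAdd_mul, ← map_mul]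
    simp [Word.toFreeGroup]

theorem exists_degreeHom_eq_one (G : Type u) {m : ℕ} {e f : Fin m → ℤ} (h : f ⬝ᵥ e = 1) :
    ∃ t, degreeHom G e t = Multiplicative.ofAdd 1 := by
  have hmem : ∏ j, Multiplicative.ofAdd (e j) ^ f j ∈ (degreeHom G e).range :=
    Subgroup.prod_mem _ fun j _ => Subgroup.zpow_mem _
      (MonoidHom.mem_range.2 ⟨FreeGroup.of (Sum.inr j), by simp [degreeHom]⟩) _
  obtain ⟨t, ht⟩ := hmem
  refine ⟨t, ht.trans ?_⟩
  rw [← h, dotProduct, ofAdd_sum]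
  exact Finset.prod_congr rfl fun j _ => by rw [← ofAdd_zsmul, smul_eq_mul]

/-- The homomorphisms that correspond to the solutions of a system. -/
def System.homs {G : Type u} [Group G] {I : Type v} {m : ℕ} (S : System G I m) :
    Set (FreeGroup (G ⊕ Fin m) →* G) :=
  {φ | (∀ g ∈ S.coefficients, φ (FreeGroup.of (Sum.inl g)) = g) ∧
    (∀ g ∉ S.coefficients, φ (FreeGroup.of (Sum.inl g)) = 1) ∧
    ∀ i, φ (Word.toFreeGroup (S i)) = 1}

theorem System.mk_homs {G : Type u} [Group G] {I : Type v} {m : ℕ} (S : System G I m) :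
    Cardinal.mk S.homs = Cardinal.mk S.solutions := by
  classical
  let f : S.homs → S.solutions := fun φ =>
    ⟨fun j => φ.1 (FreeGroup.of (Sum.inr j)), fun i => by
      rw [← map_toFreeGroup φ.1 (S i) fun g hg => φ.2.1 g ⟨i, hg⟩]
      exact φ.2.2.2 i⟩
  refine Cardinal.mk_congr (Equiv.ofBijective f ⟨fun φ ψ h => ?_, fun x => ?_⟩)
  · refine Subtype.ext (FreeGroup.ext_hom _ _ fun a => ?_)
    rcases a with g | j
    · by_cases hg : g ∈ S.coefficients
      · rw [φ.2.1 g hg, ψ.2.1 g hg]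
      · rw [φ.2.2.1 g hg, ψ.2.2.1 g hg]
    · exact congrFun (congrArg Subtype.val h) j
  · let φ : FreeGroup (G ⊕ Fin m) →* G :=
      -- Letters of elements that are not coefficients go to 1, not to themselves: H need not
      -- centralize them, and the set must be stable under conjugation by H.
      FreeGroup.lift (Sum.elim (fun g => if g ∈ S.coefficients then g else 1) x.1)
    have h1 : ∀ g ∈ S.coefficients, φ (FreeGroup.of (Sum.inl g)) = g := fun g hg => by
      simp [φ, hg]
    have h2 : ∀ g ∉ S.coefficients, φ (FreeGroup.of (Sum.inl g)) = 1 := fun g hg => by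
      simp [φ, hg]
    have h3 : (fun j => φ (FreeGroup.of (Sum.inr j))) = x.1 := by
      funext j
      simp [φ]
    refine ⟨⟨φ, h1, h2, fun i => ?_⟩, Subtype.ext h3⟩
    rw [map_toFreeGroup φ (S i) fun g hg => h1 g ⟨i, hg⟩, h3]
    exact x.2 i

theorem mk_subgroup_dvd_mk_solutions {G : Type u} [Group G] {I : Type v} {m : ℕ} (hm : 1 ≤ m)
    (S : System G I m) (H : Subgroup G) (hHC : H ≤ Subgroup.centralizer S.coefficients)
    (hH : Cardinal.mk H ∣ ((Delta S.matrix m / Delta S.matrix (m - 1) : ℕ) : Cardinal.{u})) :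
    Cardinal.mk H ∣ Cardinal.mk S.solutions := by
  obtain ⟨e, f, hfe, hdvd⟩ := exists_unimodular_vector hm S.matrix
  obtain ⟨t, ht⟩ := exists_degreeHom_eq_one G hfe
  rw [← S.mk_homs]
  refine mk_dvd_mk_of_conjHom_mem ht hH S.homs ?_ ?_
  · rintro h hh φ ⟨h1, h2, h3⟩
    refine ⟨fun g hg => ?_, fun g hg => ?_, fun i => ?_⟩
    · rw [conjHom_apply, h1 g hg, ← Subgroup.mem_centralizer_iff.1 (hHC hh) g hg,
        mul_inv_cancel_right]
    · rw [conjHom_apply, h2 g hg, mul_one, mul_inv_cancel]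
    · rw [conjHom_apply, h3 i, mul_one, mul_inv_cancel]
  · rintro φ ⟨h1, h2, h3⟩ ψ hψ
    have hcoeff : ∀ g, ψ (FreeGroup.of (Sum.inl g)) = φ (FreeGroup.of (Sum.inl g)) := fun g =>
      hψ _ (by rw [mem_degreeSubgroup]; simp [degreeHom])
    refine ⟨fun g hg => (hcoeff g).trans (h1 g hg), fun g hg => (hcoeff g).trans (h2 g hg),
      fun i => (hψ _ ?_).trans (h3 i)⟩
    rw [mem_degreeSubgroup, degreeHom_toFreeGroup]
    exact hdvd i

end GroupEquations

theorem theorem1 {G : Type u} [Group G] {I : Type v} {m : ℕ} (hm : 1 ≤ m)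
    (S : GroupEquations.System G I m) :
    GroupEquations.groupGcd (Subgroup.centralizer S.coefficients)
        (GroupEquations.Delta S.matrix m / GroupEquations.Delta S.matrix (m - 1)) ∣
      Cardinal.mk S.solutions := by
  refine GroupEquations.cardinalLcm_dvd ?_
  rintro _ ⟨H, rfl, hH⟩
  have hcard : Cardinal.mk H
      = Cardinal.mk (H.map (Subgroup.centralizer S.coefficients).subtype) :=
    Cardinal.mk_congr (H.equivMapOfInjective _ (Subgroup.subtype_injective _)).toEquiv
  rw [hcard] at hH ⊢
  exact GroupEquations.mk_subgroup_dvd_mk_solutions hm S _ (Subgroup.map_subtype_le H) hH
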